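/- Let $n\ge 1$ and let $X_1,\dots,X_n$ be i.i.d. random variables with values in $[0,\infty)$ whose common distribution is not compactly supported. Then there is a function $\alpha_n:\mathbb{R}\to\mathbb{R}$, not depending on $\lambda$, with $$\limsup_{m\to\infty}\alpha_n(m)=\infty,$$ such that for every $\lambda=(\lambda_1,\dots,\lambda_n)\in(0,1)^n$ with $\sum_{j=1}^n\lambda_j=1$ and every $m\in\mathbb{R}$, $$\frac{\mathbb{P}\left(\sum_{j=1}^n\lambda_jX_j>m\right)}{\mathbb{P}(X_1>m)^n}\ \ge\ \alpha_n(m).$$ (For $n=1$ there is no such $\lambda$, so the statement is about $n\ge 2$.) -/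

import Mathlib

open MeasureTheory ProbabilityTheory Filter

/-!
Write `T x = μ (x, ∞)` for the tail of the common law `μ`. If `l j ≤ l i`, `X j ≤ m` and
`X i + X j > 2 * m`, then `l i * X i + l j * X j > (l i + l j) * m`; asking in addition that all
other variables exceed `m` gives, by independence (`prod_mul_pow_le_measureReal_sum`),
`P (∑ k, l k * X k > m) ≥ A m * T m ^ (n - 2)`, where `A m` is the probability that an independent
pair `(X, Y)` with law `μ` satisfies `Y ≤ m` and `X + Y > 2 * m`. So `α m = A m / T m ^ 2` bounds
the quotient for all weights, and it remains to see that it is unbounded as `m → ∞`.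

Covering the event `A` from inside by a staircase of disjoint rectangles
(`staircase_sum_le_prod`) bounds `A m` below by Stieltjes sums of `δ ↦ T (m + δ)` against
`δ ↦ T (m - δ)`. Fix a large exponent `C`.

* If `T (4 * m) ≥ T m / 2 ^ (C + 1)` for arbitrarily large `m`, then one step, covering
  `X > 3 * m`, `Y ≤ m`, is of order `T m`, which beats `T m ^ 2` because `T m → 0`.
* Otherwise take `R` large and let `m` maximise `(R - y) ^ C / T y` over `0 ≤ y < R` up to a factor
  `2`. The fast decay of `T` forces `m ≥ R / 8`, and maximality says that
  `T y ≥ T m / 2 * ((R - y) / (R - m)) ^ C` on `[0, R)`. Inserting these lower bounds, which Abel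
  summation allows although increments of `T` appear (`sum_mul_sub_add_boundary_le`), the sum
  is, up to a bounded multiple of `T m ^ 2`, at least a constant times
  `T m ^ 2 * ∫ (1 - u) ^ C d((1 + u) ^ C)`, which is of order `√C * T m ^ 2`: the first `√(C / 2)`
  steps of length `1 / C` in `u` contribute equally up to constants (`le_sum_of_power_law_le`).
-/

/-! ### Real inequalities -/

/-- Comparison for Abel sums: replacing `S` by a minorant `s` in the Stieltjes sum of an
antitone weight `w` against the increments of `S` costs only boundary terms. -/
lemma sum_mul_sub_add_boundary_le {w S s : ℕ → ℝ} {N : ℕ} (hw : Antitone w)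
    (h : ∀ i ≤ N, s i ≤ S i) :
    ∑ i ∈ Finset.range N, w (i + 1) * (s (i + 1) - s i) + w N * (S N - s N)
        - w 0 * (S 0 - s 0)
      ≤ ∑ i ∈ Finset.range N, w (i + 1) * (S (i + 1) - S i) := by
  induction N with
  | zero => simp
  | succ N ih =>
    have h1 := ih fun i hi => h i (by omega)
    rw [Finset.sum_range_succ, Finset.sum_range_succ]
    have h2 := mul_le_mul_of_nonneg_right (hw N.le_succ) (sub_nonneg.2 (h N (by omega)))
    simp only [Nat.succ_eq_add_one] at h2
    nlinarith

lemma one_sixth_le_pow_mul_pow_sub_pow {C : ℕ} (hC : 0 < C) {u v : ℝ} (hu : 0 ≤ u)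
    (huv : v = u + 1 / C) (hv : v ≤ 1) (hCv : C * v ^ 2 ≤ 1 / 2) :
    1 / 6 ≤ (1 - v) ^ C * ((1 + v) ^ C - (1 + u) ^ C) := by
  have hC' : (0 : ℝ) < C := by exact_mod_cast hC
  have hinv : (0 : ℝ) < 1 / C := by positivity
  have h1 : (1 + u) * (1 + 1 / C / 2) ≤ 1 + v := by nlinarith
  have h2 : (3 / 2 : ℝ) ≤ (1 + 1 / C / 2) ^ C := by
    refine le_trans (le_of_eq ?_) (one_add_mul_le_pow (by linarith) C)
    field_simp
    norm_num
  have h3 : (1 + u) ^ C * (3 / 2) ≤ (1 + v) ^ C := by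
    calc (1 + u) ^ C * (3 / 2) ≤ (1 + u) ^ C * (1 + 1 / C / 2) ^ C := by gcongr
      _ = ((1 + u) * (1 + 1 / C / 2)) ^ C := (mul_pow _ _ _).symm
      _ ≤ (1 + v) ^ C := by gcongr
  have h4 : (1 / 2 : ℝ) ≤ (1 - v) ^ C * (1 + v) ^ C := by
    rw [← mul_pow]
    have h := one_add_mul_le_pow (a := -v ^ 2) (by nlinarith) C
    rw [show (1 - v) * (1 + v) = 1 + -v ^ 2 by ring]
    linarith
  have h5 : (0 : ℝ) ≤ (1 - v) ^ C := pow_nonneg (by linarith) C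
  nlinarith [mul_le_mul_of_nonneg_left h3 h5]

lemma exists_forall_le_two_mul {ι : Type*} {f : ι → ℝ} {s : Set ι} (hs : s.Nonempty)
    (hpos : ∀ y ∈ s, 0 < f y) (hbdd : BddAbove (f '' s)) :
    ∃ m ∈ s, ∀ y ∈ s, f y ≤ 2 * f m := by
  obtain ⟨y₀, hy₀⟩ := hs
  have h0 : 0 < sSup (f '' s) := (hpos y₀ hy₀).trans_le (le_csSup hbdd ⟨y₀, hy₀, rfl⟩)
  obtain ⟨_, ⟨m, hm, rfl⟩, hlt⟩ :=
    exists_lt_of_lt_csSup (Set.Nonempty.image f ⟨y₀, hy₀⟩) (half_lt_self h0)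
  exact ⟨m, hm, fun y hy => by linarith [le_csSup hbdd ⟨y, hy, rfl⟩]⟩

/-! ### Staircase sums of a tail function -/

/-- If `T` dominates half of the power law `T m * ((R - y) / (R - m)) ^ C` on `[0, R)`, where
`C = 2 * N ^ 2`, then each of `N` steps of width `(R - m) / C` contributes at least
`T m ^ 2 / 24` to the Stieltjes sum at `m`. -/
lemma le_sum_of_power_law_le {T : ℝ → ℝ} (hanti : Antitone T) (hpos : ∀ x, 0 < T x)
    {N C : ℕ} (hN : 4 ≤ N) (hC : C = 2 * N ^ 2) {m R : ℝ} (hmR : m < R) (hRm : R ≤ 8 * m)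
    (hpow : ∀ y ∈ Set.Ico 0 R, T m / 2 * ((R - y) / (R - m)) ^ C ≤ T y) :
    (N / 24 - 1 / 2) * T m ^ 2 ≤ ∑ i ∈ Finset.range N,
      T (m + (i + 1 : ℕ) / C * (R - m)) *
        (T (m - (i + 1 : ℕ) / C * (R - m)) - T (m - (i : ℕ) / C * (R - m))) := by
  have hN' : (4 : ℝ) ≤ N := by exact_mod_cast hN
  have hC' : (C : ℝ) = 2 * N ^ 2 := by exact_mod_cast hC
  have hCpos : (0 : ℝ) < C := by rw [hC']; positivity
  have hρ : 0 < R - m := by linarith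
  have hu : ∀ i ≤ N, (i : ℝ) / C ≤ 1 / (2 * N) := by
    intro i hi
    have hi' : (i : ℝ) ≤ N := by exact_mod_cast hi
    rw [hC', div_le_div_iff₀ (by positivity) (by positivity)]
    nlinarith
  have hN8 : 1 / (2 * (N : ℝ)) ≤ 1 / 8 := by gcongr; linarith
  have hTm := hpos m
  have hlow : ∀ i ≤ N, T m / 2 * (1 + (i : ℝ) / C) ^ C ≤ T (m - (i : ℝ) / C * (R - m)) := by
    intro i hi
    have h1 := hu i hi
    have h2 : (0 : ℝ) ≤ i / C := by positivity
    convert hpow (m - (i : ℝ) / C * (R - m)) ⟨by nlinarith, by nlinarith⟩ using 3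
    field_simp
    ring
  have hhigh : ∀ i ≤ N, T m / 2 * (1 - (i : ℝ) / C) ^ C ≤ T (m + (i : ℝ) / C * (R - m)) := by
    intro i hi
    have h1 := hu i hi
    have h2 : (0 : ℝ) ≤ i / C := by positivity
    convert hpow (m + (i : ℝ) / C * (R - m)) ⟨by nlinarith, by nlinarith⟩ using 3
    field_simp
    ring
  have hw : Antitone fun i : ℕ => T (m + (i : ℝ) / C * (R - m)) := fun i j hij =>
    hanti (by gcongr)
  have key := sum_mul_sub_add_boundary_le hw hlow
  have hb := mul_nonneg (hpos (m + (N : ℝ) / C * (R - m))).le (sub_nonneg.2 (hlow N le_rfl))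
  have hsum : ∑ _i ∈ Finset.range N, T m ^ 2 / 24 ≤ ∑ i ∈ Finset.range N,
      T (m + (i + 1 : ℕ) / C * (R - m)) * (T m / 2 * (1 + (i + 1 : ℕ) / C) ^ C
        - T m / 2 * (1 + (i : ℕ) / C) ^ C) := by
    refine Finset.sum_le_sum fun i hi => ?_
    have hi' : i + 1 ≤ N := Finset.mem_range.1 hi
    have h1 := hu (i + 1) hi'
    have h2 : (0 : ℝ) ≤ i / C := by positivity
    have h3 : (0 : ℝ) ≤ (i + 1 : ℕ) / C := by positivity
    have h4 : C * (((i + 1 : ℕ) : ℝ) / C) ^ 2 ≤ 1 / 2 := by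
      calc C * (((i + 1 : ℕ) : ℝ) / C) ^ 2 ≤ C * (1 / (2 * N)) ^ 2 := by gcongr
        _ = 1 / 2 := by rw [hC']; field_simp
    have h5 := one_sixth_le_pow_mul_pow_sub_pow (C := C) (by exact_mod_cast hCpos) h2
      (v := (i + 1 : ℕ) / C) (by push_cast; ring) (by linarith) h4
    have h6 : (1 + (i : ℝ) / C) ^ C ≤ (1 + (i + 1 : ℕ) / C) ^ C := by
      gcongr
      simp
    calc T m ^ 2 / 24 = T m ^ 2 / 4 * (1 / 6) := by ring
      _ ≤ T m ^ 2 / 4 * ((1 - (i + 1 : ℕ) / C) ^ C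
            * ((1 + (i + 1 : ℕ) / C) ^ C - (1 + (i : ℝ) / C) ^ C)) := by gcongr
      _ = T m / 2 * (1 - (i + 1 : ℕ) / C) ^ C
            * (T m / 2 * ((1 + (i + 1 : ℕ) / C) ^ C - (1 + (i : ℝ) / C) ^ C)) := by ring
      _ ≤ T (m + (i + 1 : ℕ) / C * (R - m))
            * (T m / 2 * ((1 + (i + 1 : ℕ) / C) ^ C - (1 + (i : ℝ) / C) ^ C)) := by
        have h7 : 0 ≤ T m / 2 * ((1 + (i + 1 : ℕ) / C) ^ C - (1 + (i : ℝ) / C) ^ C) :=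
          mul_nonneg (by positivity) (sub_nonneg.2 h6)
        exact mul_le_mul_of_nonneg_right (hhigh (i + 1) hi') h7
      _ = _ := by ring
  rw [Finset.sum_const, Finset.card_range, nsmul_eq_mul] at hsum
  simp only [Nat.cast_zero, zero_div, zero_mul, add_zero, sub_zero, one_pow, mul_one] at key
  nlinarith

/-- Some arbitrarily far `m` admits a staircase whose Stieltjes sum exceeds `K * T m ^ 2`.
Heavy and light tails are separated by comparing `T (4 * x)` with a fixed multiple of `T x`. -/
lemma exists_staircase {T : ℝ → ℝ} (hanti : Antitone T) (hpos : ∀ x, 0 < T x)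
    (hlim : Tendsto T atTop (nhds 0)) (hneg : ∀ x < 0, T x = 1) (K M : ℝ) :
    ∃ m ≥ M, ∃ (N : ℕ) (d : ℕ → ℝ), Monotone d ∧ d 0 = 0 ∧
      K * T m ^ 2 ≤ ∑ i ∈ Finset.range N,
        T (m + d (i + 1)) * (T (m - d (i + 1)) - T (m - d i)) := by
  obtain ⟨N, hN⟩ := exists_nat_ge (max 4 (24 * (K + 1)))
  have hN4 : 4 ≤ N := by exact_mod_cast (le_max_left _ _).trans hN
  have hNK : 24 * (K + 1) ≤ N := (le_max_right _ _).trans hN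
  obtain ⟨C, hC⟩ : ∃ C : ℕ, C = 2 * N ^ 2 := ⟨_, rfl⟩
  by_cases hheavy : ∃ᶠ x in atTop, T x / 2 ^ (C + 1) ≤ T (4 * x)
  · have hK : Tendsto (fun x => K * T x) atTop (nhds 0) := by simpa using hlim.const_mul K
    have e1 := hlim.eventually (eventually_le_nhds (show (0 : ℝ) < 1 / 2 by norm_num))
    have e2 := hK.eventually
      (eventually_le_nhds (show (0 : ℝ) < 1 / 2 ^ (C + 1) / 2 by positivity))
    obtain ⟨m, hm, ⟨⟨h1, h2⟩, hmM⟩, hm1⟩ := (hheavy.and_eventually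
      (((e1.and e2).and (eventually_ge_atTop M)).and (eventually_ge_atTop 1))).exists
    refine ⟨m, hmM, 1, fun i => i * (2 * m), fun i j hij => ?_, by simp, ?_⟩
    · have : (i : ℝ) ≤ j := by exact_mod_cast hij
      dsimp only
      nlinarith
    · have h3 : T (m - 2 * m) = 1 := hneg _ (by linarith)
      have h4 : T (4 * m) ≤ T (m + 2 * m) := hanti (by linarith)
      simp only [Finset.range_one, Finset.sum_singleton, zero_add, Nat.cast_one, one_mul,
        Nat.cast_zero, zero_mul, sub_zero, h3]
      have hTm := hpos m
      calc K * T m ^ 2 = K * T m * T m := by ring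
        _ ≤ 1 / 2 ^ (C + 1) / 2 * T m := by gcongr
        _ = T m / 2 ^ (C + 1) * (1 / 2) := by ring
        _ ≤ T (m + 2 * m) * (1 / 2) := by gcongr; exact hm.trans h4
        _ ≤ T (m + 2 * m) * (1 - T m) :=
          mul_le_mul_of_nonneg_left (by linarith) (hpos _).le
  · simp only [not_frequently, not_le] at hheavy
    obtain ⟨x, ⟨hx, hxM⟩, hx1⟩ :=
      ((hheavy.and (eventually_ge_atTop M)).and (eventually_ge_atTop 1)).exists
    obtain ⟨m, ⟨hm0, hmR⟩, hmax⟩ := exists_forall_le_two_mul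
      (f := fun y => (8 * x - y) ^ C / T y) (s := Set.Ico 0 (8 * x))
      ⟨0, by simp; linarith⟩
      (fun y hy => div_pos (pow_pos (by linarith [hy.2]) _) (hpos y))
      ⟨(8 * x) ^ C / T (8 * x), by
        rintro _ ⟨y, hy, rfl⟩
        exact div_le_div₀ (by positivity)
          (pow_le_pow_left₀ (by linarith [hy.2]) (by linarith [hy.1]) _) (hpos _)
            (hanti hy.2.le)⟩
    have hTx := hpos x
    have hT4 := hpos (4 * x)
    have hTm := hpos m
    -- Points left of `x` are far from maximal, as witnessed by the midpoint `4 * x`.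
    have hxm : x ≤ m := by
      by_contra! hlt
      have h1 := hmax (4 * x) ⟨by linarith, by linarith⟩
      have h2 : (8 * x - m) ^ C / T m ≤ (8 * x) ^ C / T x :=
        div_le_div₀ (by positivity) (pow_le_pow_left₀ (by linarith) (by linarith) _) hTx
          (hanti hlt.le)
      have h3 : 2 * ((8 * x) ^ C / T x) < (8 * x - 4 * x) ^ C / T (4 * x) := by
        rw [lt_div_iff₀ hT4]
        calc 2 * ((8 * x) ^ C / T x) * T (4 * x)
            < 2 * ((8 * x) ^ C / T x) * (T x / 2 ^ (C + 1)) := by gcongr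
          _ = (8 * x - 4 * x) ^ C := by
            rw [show 8 * x - 4 * x = 8 * x / 2 by ring, div_pow, pow_succ]
            field_simp
      linarith
    refine ⟨m, hxM.trans hxm, N, fun i => i / C * (8 * x - m), fun i j hij => ?_, by simp, ?_⟩
    · have : 0 ≤ 8 * x - m := by linarith
      dsimp only
      gcongr
    · refine le_trans ?_ (le_sum_of_power_law_le hanti hpos hN4 hC hmR (by linarith) ?_)
      · gcongr
        linarith
      · intro y hy
        have h1 := hmax y hy
        have hp : 0 < (8 * x - m) ^ C := pow_pos (by linarith) _
        rw [div_le_iff₀ (hpos y)] at h1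
        rw [div_pow, ← mul_div_assoc, div_le_iff₀ hp]
        have h2 : T m * (8 * x - y) ^ C ≤ T m * (2 * ((8 * x - m) ^ C / T m) * T y) := by
          gcongr
        have h3 : T m * (2 * ((8 * x - m) ^ C / T m) * T y) = 2 * (T y * (8 * x - m) ^ C) := by
          field_simp
        linarith

/-! ### Laws on the real line -/

/-- The staircase of disjoint rectangles `X > m + d (i + 1)`, `m - d (i + 1) < Y ≤ m - d i` lies
in the event `Y ≤ m`, `X + Y > 2 * m`. -/
lemma staircase_sum_le_prod (μ : Measure ℝ) [IsProbabilityMeasure μ] (m : ℝ) (N : ℕ)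
    {d : ℕ → ℝ} (hd : Monotone d) (hd0 : d 0 = 0) :
    ∑ i ∈ Finset.range N, μ.real (Set.Ioi (m + d (i + 1))) *
        (μ.real (Set.Ioi (m - d (i + 1))) - μ.real (Set.Ioi (m - d i)))
      ≤ (μ.prod μ).real {p : ℝ × ℝ | p.2 ≤ m ∧ 2 * m < p.1 + p.2} := by
  have hanti : Antitone fun i => m - d i := fun i j hij => sub_le_sub_left (hd hij) m
  have hstep : ∀ i, μ.real (Set.Ioi (m + d (i + 1))) *
        (μ.real (Set.Ioi (m - d (i + 1))) - μ.real (Set.Ioi (m - d i)))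
      = (μ.prod μ).real (Set.Ioi (m + d (i + 1)) ×ˢ Set.Ioc (m - d (i + 1)) (m - d i)) := by
    intro i
    rw [measureReal_prod_prod, ← Set.Ioi_sdiff_Ioi, measureReal_sdiff
      (Set.Ioi_subset_Ioi (hanti i.le_succ)) measurableSet_Ioi]
  simp_rw [hstep]
  rw [← measureReal_biUnion_finset]
  · refine measureReal_mono (Set.iUnion₂_subset fun i _ => ?_)
    rintro ⟨x, y⟩ ⟨hx, hy⟩
    simp only [Set.mem_Ioi, Set.mem_Ioc] at hx hy
    have := hd i.zero_le
    exact ⟨by dsimp only; linarith, by dsimp only; linarith⟩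
  · intro i _ j _ hij
    exact Set.disjoint_prod.2 (Or.inr (hanti.pairwise_disjoint_on_Ioc_succ hij))
  · exact fun i _ => measurableSet_Ioi.prod measurableSet_Ioc

lemma measureReal_Ioi_pos {μ : Measure ℝ} [IsProbabilityMeasure μ] (h0 : μ (Set.Iio 0) = 0)
    (hsupp : ¬ IsCompact μ.support) (x : ℝ) : 0 < μ.real (Set.Ioi x) := by
  refine ENNReal.toReal_pos (fun hx => hsupp ?_) (measure_ne_top _ _)
  refine isCompact_Icc.of_isClosed_subset (s := Set.Icc 0 x) Measure.isClosed_support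
    (Measure.support_subset_of_isClosed isClosed_Icc ?_)
  rw [mem_ae_iff]
  refine measure_mono_null (fun y hy => ?_) (measure_union_null h0 hx)
  simpa only [Set.mem_union, Set.mem_Iio, Set.mem_Ioi, Set.mem_compl_iff, Set.mem_Icc, not_and_or,
    not_le] using hy

lemma tendsto_measureReal_Ioi_atTop (μ : Measure ℝ) [IsProbabilityMeasure μ] :
    Tendsto (fun x => μ.real (Set.Ioi x)) atTop (nhds 0) := by
  have h := (tendsto_cdf_atTop μ).const_sub 1
  rw [sub_self] at h
  refine h.congr fun x => ?_
  rw [cdf_eq_real, ← probReal_compl_eq_one_sub measurableSet_Iic, Set.compl_Iic]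

/-! ### Weighted sums of independent variables -/

/-- For weights `l j ≤ l i`, the pair `(X i, X j)` lying in `{X j ≤ m, X i + X j > 2 * m}` and all
other variables exceeding `m` force the weighted average above `m`. -/
lemma lt_sum_mul_of_pair {ι : Type*} [Fintype ι] [DecidableEq ι] {l x : ι → ℝ} {m : ℝ} {i j : ι}
    (hij : i ≠ j) (hl : ∀ k, 0 < l k) (hsum : ∑ k, l k = 1) (hle : l j ≤ l i)
    (hj : x j ≤ m) (hpair : 2 * m < x i + x j) (hrest : ∀ k ∈ ({i, j} : Finset ι)ᶜ, m < x k) :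
    m < ∑ k, l k * x k := by
  have h1 : 0 < ∑ k, l k * (x k - m) := by
    rw [← Finset.sum_add_sum_compl {i, j}, Finset.sum_pair hij]
    refine add_pos_of_pos_of_nonneg ?_ (Finset.sum_nonneg fun k hk =>
      mul_nonneg (hl k).le (sub_nonneg.2 (hrest k hk).le))
    nlinarith [mul_pos (hl i) (sub_pos.2 hpair),
      mul_nonneg (sub_nonneg.2 hle) (sub_nonneg.2 hj)]
  simp only [mul_sub, Finset.sum_sub_distrib, ← Finset.sum_mul, hsum] at h1
  linarith

/-- Independence turns the sufficient event of `lt_sum_mul_of_pair` into a lower bound which no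
longer involves the weights. -/
lemma prod_mul_pow_le_measureReal_sum {Ω : Type*} [MeasurableSpace Ω] {P : Measure Ω}
    [IsProbabilityMeasure P] {n : ℕ} {X : Fin n → Ω → ℝ} {μ : Measure ℝ} (hindep : iIndepFun X P)
    (hX : ∀ i, AEMeasurable (X i) P) (hμ : ∀ i, P.map (X i) = μ)
    {l : Fin n → ℝ} (hl : ∀ k, 0 < l k) (hsum : ∑ k, l k = 1) {i j : Fin n} (hij : i ≠ j)
    (hle : l j ≤ l i) (m : ℝ) :
    (μ.prod μ).real {p : ℝ × ℝ | p.2 ≤ m ∧ 2 * m < p.1 + p.2} * μ.real (Set.Ioi m) ^ (n - 2)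
      ≤ P.real {ω | m < ∑ k, l k * X k ω} := by
  have hA : MeasurableSet {p : ℝ × ℝ | p.2 ≤ m ∧ 2 * m < p.1 + p.2} :=
    (measurableSet_le measurable_snd measurable_const).inter
      (measurableSet_lt measurable_const (measurable_fst.add measurable_snd))
  have hpair : (P.map fun ω => (X i ω, X j ω)) = μ.prod μ := by
    rw [(hindep.indepFun hij).map_prod_eq_prod_map_map (hX i) (hX j), hμ, hμ]
  have hrest : P.real (⋂ k ∈ ({i, j} : Finset (Fin n))ᶜ, X k ⁻¹' Set.Ioi m)
      = μ.real (Set.Ioi m) ^ (n - 2) := by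
    rw [measureReal_def, hindep.measure_inter_preimage_eq_mul _ (fun _ _ => measurableSet_Ioi),
      ENNReal.toReal_prod, Finset.prod_congr rfl (g := fun _ => μ.real (Set.Ioi m)),
      Finset.prod_const, Finset.card_compl, Finset.card_pair hij, Fintype.card_fin]
    intro k _
    rw [← hμ k, measureReal_def, Measure.map_apply_of_aemeasurable (hX k) measurableSet_Ioi]
  have hind := (hindep.indepFun_finset₀ {i, j} ({i, j}ᶜ) disjoint_compl_right hX).comp
    (φ := fun x : ({i, j} : Finset (Fin n)) → ℝ => (x ⟨i, by simp⟩, x ⟨j, by simp⟩)) (ψ := id)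
    (by fun_prop) measurable_id
  have hmul := hind.measure_inter_preimage_eq_mul _ (Set.univ.pi fun _ => Set.Ioi m) hA
    (MeasurableSet.univ_pi fun _ => measurableSet_Ioi)
  have hset : (id ∘ fun (ω : Ω) (k : ({i, j}ᶜ : Finset (Fin n))) => X k ω) ⁻¹'
      (Set.univ.pi fun _ => Set.Ioi m)
      = ⋂ k ∈ ({i, j} : Finset (Fin n))ᶜ, X k ⁻¹' Set.Ioi m := by
    ext ω
    simp
  rw [hset] at hmul
  rw [← hpair, map_measureReal_apply_of_aemeasurable ((hX i).prodMk (hX j)) hA, ← hrest,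
    measureReal_def, measureReal_def, ← ENNReal.toReal_mul]
  refine (congrArg ENNReal.toReal hmul.symm).trans_le (measureReal_mono ?_)
  rintro ω ⟨⟨h1, h2⟩, h3⟩
  exact lt_sum_mul_of_pair hij hl hsum hle h1 h2 fun k hk => Set.mem_iInter₂.1 h3 k hk

theorem theorem2 {Ω : Type*} [MeasurableSpace Ω] (P : Measure Ω) [IsProbabilityMeasure P]
    (n : ℕ) [NeZero n] (X : Fin n → Ω → ℝ)
    (hindep : iIndepFun X P)
    (hident : ∀ i, IdentDistrib (X i) (X 0) P P)
    (hnonneg : ∀ i, ∀ᵐ ω ∂P, 0 ≤ X i ω)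
    (hsupp : ¬ IsCompact (P.map (X 0)).support) :
    ∃ α : ℝ → ℝ,
      limsup (fun m : ℝ => (α m : EReal)) atTop = ⊤ ∧
      ∀ l : Fin n → ℝ, (∀ j, l j ∈ Set.Ioo (0 : ℝ) 1) → ∑ j, l j = 1 →
        ∀ m : ℝ,
          α m ≤ P.real {ω | m < ∑ j, l j * X j ω} / P.real {ω | m < X 0 ω} ^ n := by
  set μ := P.map (X 0) with hμdef
  have hX : ∀ i, AEMeasurable (X i) P := fun i => (hident i).aemeasurable_fst
  have hμ : ∀ i, P.map (X i) = μ := fun i => (hident i).map_eq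
  have : IsProbabilityMeasure μ := Measure.isProbabilityMeasure_map (hX 0)
  have hneg : μ (Set.Iio 0) = 0 := by
    rw [hμdef, Measure.map_apply_of_aemeasurable (hX 0) measurableSet_Iio]
    refine measure_mono_null (fun ω hω => ?_) (ae_iff.1 (hnonneg 0))
    exact not_le.2 hω
  have hpos : ∀ x, 0 < μ.real (Set.Ioi x) := measureReal_Ioi_pos hneg hsupp
  have hone : ∀ x < 0, μ.real (Set.Ioi x) = 1 := by
    intro x hx
    rw [← Set.compl_Iic, probReal_compl_eq_one_sub measurableSet_Iic, measureReal_def,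
      measure_mono_null (Set.Iic_subset_Iio.2 hx) hneg, ENNReal.toReal_zero, sub_zero]
  have htail : ∀ m, P.real {ω | m < X 0 ω} = μ.real (Set.Ioi m) := fun m =>
    (map_measureReal_apply_of_aemeasurable (hX 0) measurableSet_Ioi).symm
  refine ⟨fun m => (μ.prod μ).real {p : ℝ × ℝ | p.2 ≤ m ∧ 2 * m < p.1 + p.2}
    / μ.real (Set.Ioi m) ^ 2, ?_, ?_⟩
  · refine top_unique (le_of_forall_lt fun c hc => ?_)
    obtain ⟨K, hcK⟩ := EReal.lt_iff_exists_real_btwn.1 hc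
    refine hcK.1.trans_le (le_limsup_of_frequently_le ?_)
    refine frequently_atTop.2 fun M => ?_
    obtain ⟨m, hm, N, d, hd, hd0, hK⟩ := exists_staircase
      (fun x y hxy => measureReal_mono (Set.Ioi_subset_Ioi hxy)) hpos
      (tendsto_measureReal_Ioi_atTop μ) hone K M
    refine ⟨m, hm, EReal.coe_le_coe_iff.2 ?_⟩
    rw [le_div_iff₀ (pow_pos (hpos m) 2)]
    exact hK.trans (staircase_sum_le_prod μ m N hd hd0)
  · intro l hl hsum m
    have hl0 : ∀ k, 0 < l k := fun k => (hl k).1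
    -- A second index exists because `l 0 < 1 = ∑ k, l k`.
    obtain ⟨k, hk⟩ : ∃ k, k ≠ (0 : Fin n) := by
      by_contra! hall
      have h1 : ∑ k, l k = l 0 := Finset.sum_eq_single_of_mem 0 (Finset.mem_univ 0)
        fun b _ hb => absurd (hall b) hb
      linarith [(hl 0).2]
    obtain ⟨i, j, hij, hle⟩ : ∃ i j, i ≠ j ∧ l j ≤ l i := by
      rcases le_total (l k) (l 0) with h | h
      · exact ⟨0, k, hk.symm, h⟩
      · exact ⟨k, 0, hk, h⟩
    have hn : 2 ≤ n := by
      have h1 := Finset.card_le_univ ({i, j} : Finset (Fin n))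
      rwa [Finset.card_pair hij, Fintype.card_fin] at h1
    have hT := hpos m
    rw [htail, div_le_div_iff₀ (pow_pos hT 2) (pow_pos hT n), ← pow_sub_mul_pow _ hn, ← mul_assoc]
    gcongr
    exact prod_mul_pow_le_measureReal_sum hindep hX hμ hl0 hsum hij hle m
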